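/- Let $\mathrm{Top}$ be the category of all topological spaces and continuous maps. A morphism $f\colon A\to B$ has the left lifting property with respect to $g\colon C\to D$ (and $g$ has the right lifting property with respect to $f$) if for all $t\colon A\to C$ and $b\colon B\to D$ with $g\circ t=b\circ f$ there is $d\colon B\to C$ with $d\circ f=t$ and $g\circ d=b$. For a class $P$ of morphisms, $P^{l}$ (resp. $P^{r}$) is the class of all morphisms having the left (resp. right) lifting property with respect to every member of $P$; for a word $w=w_1\cdots w_n$ in the letters $l,r$ put $P^{w}=(\cdots(P^{w_1})^{w_2}\cdots)^{w_n}$. Let $P=\{\emptyset\to\{\bullet\}\}$ be the class whose only member is the map from the empty space to the one-point space. Then the orbit $\{P^{w} : w \text{ a nonempty word in } l,r\}$ of iterated orthogonals of $P$ is finite and has exactly $21$ elements. The class $P$ itself is not one of them (so, if the empty word is also allowed, $P$ is one further element). The Schreier graph of the orbit is as follows. The $21$ classes $P^w$ with $$w\in\{l,\ ll,\ lll,\ lr,\ lrr,\ lrrl,\ lrrr,\ lrrrl,\ lrrrr,\ lrrrrr,\ r,\ rl,\ rll,\ rllr,\ rllrr,\ rllrrl,\ rllrrll,\ rr,\ rrr,\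 rrrr,\ rrrrl\}$$ are pairwise distinct and are all the elements of the orbit. Writing $w$ for $P^w$, each of the letters $l$ and $r$ acts on them as follows, where each entry is $w\colon (P^{w})^{l},\ (P^{w})^{r}$: - $l\colon ll,\ lr$; $\quad ll\colon lll,\ lll$; $\quad lll\colon ll,\ ll$; $\quad lr\colon l,\ lrr$; $\quad lrr\colon lrrl,\ lrrr$; $\quad lrrl\colon rll,\ lrr$; - $lrrr\colon lrrrl,\ lrrrr$; $\quad lrrrl\colon rl,\ lrrr$; $\quad lrrrr\colon lrrr,\ lrrrrr$; $\quad lrrrrr\colon lrrrr,\ ll$; - $r\colon rl,\ rr$; $\quad rl\colon rll,\ r$; $\quad rll\colon ll,\ rllr$; $\quad rllr\colon rll,\ rllrr$; $\quad rllrr\colon rllrrl,\ rrrr$; $\quad rllrrl\colon rllrrll,\ rllrr$; $\quad rllrrll\colon ll,\ rllrrl$; - $rr\colon r,\ rrr$; $\quad rrr\colon rr,\ rrrr$; $\quad rrrr\colon rrrrl,\ ll$; $\quad rrrrl\colon rl,\ rrrr$. -/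

import Mathlib

open CategoryTheory

universe u v

namespace QuillenNegation

/-- The two generators of the free monoid acting on classes of morphisms. -/
inductive Letter : Type
  | l : Letter
  | r : Letter

/-- The action of one letter on a class of morphisms: `l` sends `P` to its left orthogonal (the
class of all morphisms having the left lifting property with respect to every member of `P`), and
`r` sends `P` to its right orthogonal. -/
def orth {C : Type u} [Category.{v} C] : Letter → MorphismProperty C → MorphismProperty C
  | Letter.l, P => P.llp
  | Letter.r, P => P.rlp

/-- The class `P ^ w` for a word `w` in `l` and `r`. Words are read from left to right: the class
`P ^ lrr` is `((P ^ l) ^ r) ^ r`. -/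
def act {C : Type u} [Category.{v} C] (P : MorphismProperty C) (w : List Letter) :
    MorphismProperty C :=
  w.foldl (fun Q a => orth a Q) P

/-- The iterated orthogonals of `P`: all classes `P ^ w` where `w` is a nonempty word. -/
def iteratedOrthogonals {C : Type u} [Category.{v} C] (P : MorphismProperty C) :
    Set (MorphismProperty C) :=
  {Q | ∃ w : List Letter, w ≠ [] ∧ Q = act P w}

/-- The map from the empty space to the one-point space. -/
def emptyToPoint : TopCat.of PEmpty.{u + 1} ⟶ TopCat.of PUnit.{u + 1} :=
  TopCat.ofHom ⟨fun x => x.elim, continuous_of_discreteTopology⟩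

/-- The class of morphisms of the category of all topological spaces whose only member is the map
from the empty space to the one-point space. -/
def emptyToPointClass : MorphismProperty TopCat.{u} :=
  MorphismProperty.ofHoms fun _ : Unit => emptyToPoint.{u}

/-- Names for the vertices of the Schreier graph. Each vertex is named by a word leading to it from
the class that consists of the map from the empty space to the one-point space. -/
inductive Vertex : Type
  | l | ll | lll | lr | lrr | lrrl | lrrr | lrrrl | lrrrr | lrrrrr
  | r | rl | rll | rllr | rllrr | rllrrl | rllrrll
  | rr | rrr | rrrr | rrrrl

/-- The word that names a vertex. -/
def Vertex.word : Vertex → List Letter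
  | .l => [.l]
  | .ll => [.l, .l]
  | .lll => [.l, .l, .l]
  | .lr => [.l, .r]
  | .lrr => [.l, .r, .r]
  | .lrrl => [.l, .r, .r, .l]
  | .lrrr => [.l, .r, .r, .r]
  | .lrrrl => [.l, .r, .r, .r, .l]
  | .lrrrr => [.l, .r, .r, .r, .r]
  | .lrrrrr => [.l, .r, .r, .r, .r, .r]
  | .r => [.r]
  | .rl => [.r, .l]
  | .rll => [.r, .l, .l]
  | .rllr => [.r, .l, .l, .r]
  | .rllrr => [.r, .l, .l, .r, .r]
  | .rllrrl => [.r, .l, .l, .r, .r, .l]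
  | .rllrrll => [.r, .l, .l, .r, .r, .l, .l]
  | .rr => [.r, .r]
  | .rrr => [.r, .r, .r]
  | .rrrr => [.r, .r, .r, .r]
  | .rrrrl => [.r, .r, .r, .r, .l]

/-- The end point of the `l`-labelled edge starting at a vertex of the Schreier graph. -/
def Vertex.left : Vertex → Vertex
  | .l => .ll
  | .ll => .lll
  | .lll => .ll
  | .lr => .l
  | .lrr => .lrrl
  | .lrrl => .rll
  | .lrrr => .lrrrl
  | .lrrrl => .rl
  | .lrrrr => .lrrr
  | .lrrrrr => .lrrrr
  | .r => .rl
  | .rl => .rll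
  | .rll => .ll
  | .rllr => .rll
  | .rllrr => .rllrrl
  | .rllrrl => .rllrrll
  | .rllrrll => .ll
  | .rr => .r
  | .rrr => .rr
  | .rrrr => .rrrrl
  | .rrrrl => .rl

/-- The end point of the `r`-labelled edge starting at a vertex of the Schreier graph. -/
def Vertex.right : Vertex → Vertex
  | .l => .lr
  | .ll => .lll
  | .lll => .ll
  | .lr => .lrr
  | .lrr => .lrrr
  | .lrrl => .lrr
  | .lrrr => .lrrrr
  | .lrrrl => .lrrr
  | .lrrrr => .lrrrrr
  | .lrrrrr => .ll
  | .r => .rr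
  | .rl => .r
  | .rll => .rllr
  | .rllr => .rllrr
  | .rllrr => .rrrr
  | .rllrrl => .rllrr
  | .rllrrll => .rllrrl
  | .rr => .rrr
  | .rrr => .rrrr
  | .rrrr => .ll
  | .rrrrl => .rrrr

/-- The class of continuous maps attached to a vertex. -/
def Vertex.toClass (x : Vertex) : MorphismProperty TopCat.{u} :=
  act emptyToPointClass.{u} x.word

end QuillenNegation

/-!
Taking orthogonals is a Galois connection: once `P.llp = L` and `L.rlp = R` are known, `R.llp = L`
is automatic, so most edges of the graph come in pairs of classes orthogonal to each other. One of
the two inclusions in `P.llp = Q` or `P.rlp = Q` is a direct construction of lifts. For the other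
one, lifts in a few well-chosen squares suffice: either one end of the square is a space with few
points, or the square exhibits the map as a retract of a member of `Q`.

Two squares need large auxiliary spaces. Every `h : X ⟶ Y` extends over a union of `X` with so many
copies of `Y`, accumulating at `X`, that a retraction onto `X` must be generic in its fibre on some
copy (`Slices`); this identifies `clopenDense.rlp.rlp`. Every `f : A ⟶ B` embeds into a quotient map
to `B` with infinite fibres which is left orthogonal to all maps with T1 fibres, and a section of it
makes the points outside the range of `f` isolated (`Sheets`); this identifies `t1Fibres.llp.llp`.

Since orthogonals of equal classes are equal, the classes at two vertices are distinct as soon as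
some word separates them. Two inequalities, of the isomorphisms and all maps, and of the maps with
dense image and those whose image meets every nonempty open and closed set, thus imply all others.
-/

namespace QuillenNegation

open Topology Filter Set

section Category

variable {C : Type u} [Category.{v} C] {L R P : MorphismProperty C}

/-- `L` and `R` are the orthogonals of each other, as in a weak factorization system, but no
factorizations are required. -/
structure IsLiftingPair (L R : MorphismProperty C) : Prop where
  rlp_eq : L.rlp = R
  llp_eq : R.llp = L

theorem IsLiftingPair.of_le (h : L ≤ R.llp) (hL : R.llp ≤ L) (hR : L.rlp ≤ R) :
    IsLiftingPair L R where
  rlp_eq := hR.antisymm ((MorphismProperty.le_llp_iff_le_rlp L R).1 h)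
  llp_eq := hL.antisymm h

theorem IsLiftingPair.of_llp_eq (hL : P.llp = L) (hR : L.rlp = R) : IsLiftingPair L R where
  rlp_eq := hR
  llp_eq := by rw [← hR, ← hL, P.llp_rlp_llp]

theorem IsLiftingPair.of_rlp_eq (hR : P.rlp = R) (hL : R.llp = L) : IsLiftingPair L R where
  rlp_eq := by rw [← hL, ← hR, P.rlp_llp_rlp]
  llp_eq := hL

theorem isIso_of_hasLiftingProperty_self {A B : C} {f : A ⟶ B} (h : HasLiftingProperty f f) :
    IsIso f :=
  have sq : CommSq (𝟙 A) f f (𝟙 B) := ⟨by simp⟩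
  ⟨sq.lift, sq.fac_left, sq.fac_right⟩

theorem isomorphisms_le_llp (P : MorphismProperty C) : MorphismProperty.isomorphisms C ≤ P.llp :=
  fun _ _ f (_ : IsIso f) => P.llp_of_isIso f

theorem isomorphisms_le_rlp (P : MorphismProperty C) : MorphismProperty.isomorphisms C ≤ P.rlp :=
  fun _ _ f (_ : IsIso f) => P.rlp_of_isIso f

theorem llp_eq_isomorphisms (h : P.llp ≤ P) : P.llp = MorphismProperty.isomorphisms C :=
  le_antisymm (fun _ _ f hf => isIso_of_hasLiftingProperty_self (hf f (h f hf)))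
    (isomorphisms_le_llp P)

theorem rlp_eq_isomorphisms (h : P.rlp ≤ P) : P.rlp = MorphismProperty.isomorphisms C :=
  le_antisymm (fun _ _ f hf => isIso_of_hasLiftingProperty_self (hf f (h f hf)))
    (isomorphisms_le_rlp P)

theorem isLiftingPair_isomorphisms_top : IsLiftingPair (MorphismProperty.isomorphisms C) ⊤ :=
  .of_le (isomorphisms_le_llp ⊤) (llp_eq_isomorphisms le_top).le le_top

theorem isLiftingPair_top_isomorphisms : IsLiftingPair ⊤ (MorphismProperty.isomorphisms C) :=
  .of_le ((MorphismProperty.le_llp_iff_le_rlp _ _).2 (isomorphisms_le_rlp ⊤)) le_top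
     (rlp_eq_isomorphisms le_top).le

theorem isomorphisms_le_orth (a : Letter) (P : MorphismProperty C) :
    MorphismProperty.isomorphisms C ≤ orth a P :=
  match a with
  | .l => isomorphisms_le_llp P
  | .r => isomorphisms_le_rlp P

theorem act_concat (P : MorphismProperty C) (w : List Letter) (a : Letter) :
    act P (w ++ [a]) = orth a (act P w) := by
  simp only [act, List.foldl_append, List.foldl_cons, List.foldl_nil]

theorem isomorphisms_le_of_mem_iteratedOrthogonals {Q : MorphismProperty C}
    (hQ : Q ∈ iteratedOrthogonals P) : MorphismProperty.isomorphisms C ≤ Q := by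
  obtain ⟨w, hw, rfl⟩ := hQ
  rw [← List.dropLast_append_getLast hw, act_concat]
  exact isomorphisms_le_orth _ _

end Category

theorem range_eq_preimage_range {A B Z : Type*} {f : A → B} {i : A → Z} {p : Z → B} {s : B → Z}
    (hsf : ∀ a, s (f a) = i a) (hps : Function.LeftInverse p s) (hpi : ∀ a, p (i a) = f a) :
    range f = s ⁻¹' range i := by
  refine Subset.antisymm (range_subset_iff.2 fun a => ⟨a, (hsf a).symm⟩) ?_
  rintro y ⟨a, ha⟩
  exact ⟨a, (hpi a).symm.trans ((congrArg p ha).trans (hps y))⟩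

section Lifting

variable {P : MorphismProperty TopCat.{u}} {A B X Y : TopCat.{u}}
variable {Z W : Type u} [TopologicalSpace Z] [TopologicalSpace W]

theorem hasLiftingProperty_iff (f : A ⟶ B) (g : X ⟶ Y) :
    HasLiftingProperty f g ↔ ∀ (t : C(A, X)) (b : C(B, Y)), (∀ a, g (t a) = b (f a)) →
      ∃ d : C(B, X), (∀ a, d (f a) = t a) ∧ ∀ y, g (d y) = b y := by
  refine ⟨fun h t b comm => ?_, fun h => ⟨fun {t b} sq => ?_⟩⟩
  · have sq : CommSq (TopCat.ofHom t) f g (TopCat.ofHom b) := ⟨by ext a; exact comm a⟩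
    exact ⟨sq.lift.hom, fun a => ConcreteCategory.congr_hom sq.fac_left a,
      fun y => ConcreteCategory.congr_hom sq.fac_right y⟩
  · obtain ⟨d, hdf, hgd⟩ := h t.hom b.hom fun a => ConcreteCategory.congr_hom sq.w a
    exact ⟨⟨⟨TopCat.ofHom d, by ext a; exact hdf a, by ext y; exact hgd y⟩⟩⟩

theorem exists_lift_of_llp {f : A ⟶ B} (hf : P.llp f) {g : C(Z, W)} (hg : P (TopCat.ofHom g))
    (t : C(A, Z)) (b : C(B, W)) (comm : ∀ a, g (t a) = b (f a)) :
    ∃ d : C(B, Z), (∀ a, d (f a) = t a) ∧ ∀ y, g (d y) = b y :=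
  (hasLiftingProperty_iff f (TopCat.ofHom g)).1 (hf _ hg) t b comm

theorem exists_lift_of_rlp {g : X ⟶ Y} (hg : P.rlp g) {f : C(Z, W)} (hf : P (TopCat.ofHom f))
    (t : C(Z, X)) (b : C(W, Y)) (comm : ∀ a, g (t a) = b (f a)) :
    ∃ d : C(W, X), (∀ a, d (f a) = t a) ∧ ∀ y, g (d y) = b y :=
  (hasLiftingProperty_iff (TopCat.ofHom f) g).1 (hg _ hf) t b comm

theorem exists_section_of_llp {f : A ⟶ B} (hf : P.llp f) (i : C(A, Z)) {p : C(Z, B)}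
    (hp : P (TopCat.ofHom p)) (hpi : ∀ a, p (i a) = f a) :
    ∃ s : C(B, Z), (∀ a, s (f a) = i a) ∧ Function.LeftInverse p s :=
  exists_lift_of_llp hf hp i (.id B) hpi

theorem exists_retraction_of_rlp {g : X ⟶ Y} (hg : P.rlp g) {i : C(X, Z)}
    (hi : P (TopCat.ofHom i)) (p : C(Z, Y)) (hpi : ∀ x, p (i x) = g x) :
    ∃ r : C(Z, X), Function.LeftInverse r i ∧ ∀ z, g (r z) = p z :=
  exists_lift_of_rlp hg hi (.id X) p fun x => (hpi x).symm

theorem isEmbedding_of_comp_eq {f : A ⟶ B} {i : A → Z} (hi : IsEmbedding i) {s : C(B, Z)}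
    (hsf : ∀ a, s (f a) = i a) : IsEmbedding f :=
  .of_comp f.hom.continuous s.continuous ((funext hsf : s ∘ f = i) ▸ hi)

/-- The map from a space to the one-point space. -/
def toPoint (Z : Type u) [TopologicalSpace Z] : C(Z, PUnit.{u + 1}) :=
  .const Z PUnit.unit

theorem exists_extension_of_llp {f : A ⟶ B} (hf : P.llp f) (hZ : P (TopCat.ofHom (toPoint Z)))
    (t : C(A, Z)) : ∃ d : C(B, Z), ∀ a, d (f a) = t a :=
  (exists_lift_of_llp hf hZ t (toPoint B) fun _ => rfl).imp fun _ hd => hd.1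

theorem apply_eq_of_rlp {g : X ⟶ Y} (hg : P.rlp g) (hZ : P (TopCat.ofHom (toPoint Z)))
    (t : C(Z, X)) (y : Y) (hy : ∀ z, g (t z) = y) (z z' : Z) : t z = t z' := by
  obtain ⟨d, hd, -⟩ := exists_lift_of_rlp hg hZ t (.const _ y) hy
  exact (hd z).symm.trans (hd z')

theorem eq_univ_of_llp_of_range_subset {f : A ⟶ B} (hf : P.llp f) {S : Set B}
    (hS : P (TopCat.ofHom (⟨Subtype.val, continuous_subtype_val⟩ : C(S, B))))
    (h : range f ⊆ S) : S = univ := by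
  obtain ⟨d, -, hd⟩ := exists_lift_of_llp hf hS
    ⟨fun a => ⟨f a, h ⟨a, rfl⟩⟩, f.hom.continuous.subtype_mk _⟩ (.id B) fun _ => rfl
  exact eq_univ_of_forall fun y => mem_of_eq_of_mem (hd y).symm (d y).2

theorem isEmbedding_and_range_eq_of_rlp {g : X ⟶ Y} (hg : P.rlp g) {S : Set Y} (h : ∀ x, g x ∈ S)
    (hS : P (TopCat.ofHom (⟨S.codRestrict g h, g.hom.continuous.codRestrict h⟩ : C(X, S)))) :
    IsEmbedding g ∧ range g = S := by
  obtain ⟨r, hr, hgr⟩ := exists_retraction_of_rlp hg hS ⟨_, continuous_subtype_val⟩ fun _ => rfl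
  have isEmbedding_codRestrict : IsEmbedding (S.codRestrict g h) :=
    .of_leftInverse hr r.continuous (g.hom.continuous.codRestrict h)
  refine ⟨IsEmbedding.subtypeVal.comp isEmbedding_codRestrict, ?_⟩
  exact (range_subset_iff.2 h).antisymm fun y hy => ⟨r ⟨y, hy⟩, hgr ⟨y, hy⟩⟩

end Lifting

section LiftingCriteria

variable {A B X Y : TopCat.{u}} {f : A ⟶ B} {g : X ⟶ Y}

theorem hasLiftingProperty_of_isQuotientMap (hf : IsQuotientMap f)
    (h : ∀ t : C(A, X), Function.FactorsThrough (g ∘ t) f → Function.FactorsThrough t f) :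
    HasLiftingProperty f g := by
  refine (hasLiftingProperty_iff f g).2 fun t b comm => ?_
  have factors : Function.FactorsThrough t f.hom :=
    h t fun a a' ha => (comm a).trans ((congrArg b ha).trans (comm a').symm)
  have lift_apply : ∀ a, hf.lift (f := f.hom) t factors (f a) = t a :=
    fun a => ContinuousMap.congr_fun (hf.lift_comp t factors) a
  exact ⟨_, lift_apply, hf.surjective.forall.2 fun a => by rw [lift_apply, comm]⟩

theorem hasLiftingProperty_of_isEmbedding (hg : IsEmbedding g)
    (h : ∀ b : C(B, Y), range f ⊆ b ⁻¹' range g → b ⁻¹' range g = univ) :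
    HasLiftingProperty f g := by
  refine (hasLiftingProperty_iff f g).2 fun t b comm => ?_
  have hb : b ⁻¹' range g = univ := h b (range_subset_iff.2 fun a => ⟨t a, comm a⟩)
  choose d hd using eq_univ_iff_forall.1 hb
  have continuous_d : Continuous d := hg.continuous_iff.2 (b.continuous.congr fun y => (hd y).symm)
  exact ⟨⟨d, continuous_d⟩, fun a => hg.injective ((hd (f a)).trans (comm a).symm), hd⟩

theorem hasLiftingProperty_of_leftInverse {s : C(B, A)} (hs : Function.LeftInverse f s)
    (h : ∀ (t : C(A, X)) (a : A), g (t (s (f a))) = g (t a) → t (s (f a)) = t a) :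
    HasLiftingProperty f g := by
  refine (hasLiftingProperty_iff f g).2 fun t b comm => ⟨t.comp s, fun a => h t a ?_, fun y => ?_⟩
  · rw [comm, comm, hs]
  · exact (comm (s y)).trans (congrArg b (hs y))

theorem apply_extend_eq {A B X Y : Type*} {f : A → B} {g : X → Y} {t : A → X} {b : B → Y}
    {e : B → X} (hf : Function.Injective f) (comm : ∀ a, g (t a) = b (f a))
    (he : ∀ y, g (e y) = b y) (y : B) : g (Function.extend f t e y) = b y := by
  by_cases hy : ∃ a, f a = y
  · obtain ⟨a, rfl⟩ := hy
    exact (congrArg g (hf.extend_apply t e a)).trans (comm a)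
  · exact (congrArg g (Function.extend_apply' t e y hy)).trans (he y)

theorem hasLiftingProperty_of_extend (hf : Function.Injective f)
    (h : ∀ (t : C(A, X)) (b : C(B, Y)), (∀ a, g (t a) = b (f a)) →
      ∃ e : B → X, (∀ y, g (e y) = b y) ∧ Continuous (Function.extend f t e)) :
    HasLiftingProperty f g := by
  refine (hasLiftingProperty_iff f g).2 fun t b comm => ?_
  obtain ⟨e, he, continuous_extend⟩ := h t b comm
  exact ⟨⟨_, continuous_extend⟩, hf.extend_apply t e, apply_extend_eq hf comm he⟩

end LiftingCriteria

section Extension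

variable {A B X : Type*} [TopologicalSpace A] [TopologicalSpace B] [TopologicalSpace X]
  {f : A → B} {t : A → X} {e : B → X}

theorem continuous_extend (hf : IsClosedEmbedding f) (ht : Continuous t)
    (he : ∀ y ∉ range f, ContinuousAt e y)
    (hte : ∀ a, Tendsto e (𝓝[(range f)ᶜ] (f a)) (𝓝 (t a))) :
    Continuous (Function.extend f t e) := by
  have extend_eq : EqOn (Function.extend f t e) e (range f)ᶜ :=
    fun y hy => Function.extend_apply' t e y hy
  refine continuous_iff_continuousAt.2 fun y => ?_
  by_cases hy : y ∈ range f
  · obtain ⟨a, rfl⟩ := hy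
    rw [ContinuousAt, hf.injective.extend_apply, ← nhdsWithin_univ, ← union_compl_self (range f),
      nhdsWithin_union, tendsto_sup]
    constructor
    · rw [← hf.map_nhds_eq, tendsto_map'_iff, Function.extend_comp hf.injective]
      exact ht.tendsto a
    · exact (hte a).congr' (eventually_nhdsWithin_of_forall fun y hy => (extend_eq hy).symm)
  · exact (he y hy).congr
      (eventually_of_mem (hf.isClosed_range.isOpen_compl.mem_nhds hy) fun z hz =>
        (extend_eq hz).symm)

theorem continuous_extend_of_isClopen_range (hf : IsEmbedding f) (hrange : IsClopen (range f))
    (ht : Continuous t) (he : ∀ y ∉ range f, ContinuousAt e y) :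
    Continuous (Function.extend f t e) := by
  refine continuous_extend ⟨hf, hrange.isClosed⟩ ht he fun a => ?_
  have nhdsWithin_eq_bot : 𝓝[(range f)ᶜ] (f a) = ⊥ := by
    rw [← notMem_closure_iff_nhdsWithin_eq_bot, hrange.compl.isClosed.closure_eq]
    exact fun h => h ⟨a, rfl⟩
  exact nhdsWithin_eq_bot ▸ tendsto_bot

end Extension

section Classes

/-- The maps whose source is nonempty unless their target is empty. -/
def nonemptySource : MorphismProperty TopCat.{u} := fun A B _ => Nonempty B → Nonempty A

/-- The homeomorphisms together with all maps with empty source. -/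
def emptySourceOrIso : MorphismProperty TopCat.{u} := fun A _ f => IsEmpty A ∨ IsIso f

/-- The maps with a continuous section. -/
def split : MorphismProperty TopCat.{u} := fun A B f => ∃ s : C(B, A), Function.LeftInverse f s

/-- The maps with a continuous section that picks a generic point of each fibre. -/
def genericallySplit : MorphismProperty TopCat.{u} := fun A B f =>
  ∃ s : C(B, A), Function.LeftInverse f s ∧ ∀ x, s (f x) ⤳ x

/-- The injective continuous maps. -/
def injections : MorphismProperty TopCat.{u} := fun _ _ f => Function.Injective f

/-- The surjective continuous maps. -/
def surjections : MorphismProperty TopCat.{u} := fun _ _ f => Function.Surjective f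

/-- The quotient maps. -/
def quotients : MorphismProperty TopCat.{u} := fun _ _ f => IsQuotientMap f

/-- The surjections whose source carries the induced topology. -/
def inducingSurjections : MorphismProperty TopCat.{u} := fun _ _ f =>
  Function.Surjective f ∧ IsInducing f

/-- The embeddings of subspaces. -/
def embeddings : MorphismProperty TopCat.{u} := fun _ _ f => IsEmbedding f

/-- The embeddings of closed subspaces. -/
def closedEmbeddings : MorphismProperty TopCat.{u} := fun _ _ f => IsClosedEmbedding f

/-- The embeddings of open and closed subspaces. -/
def clopenEmbeddings : MorphismProperty TopCat.{u} := fun _ _ f =>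
  IsEmbedding f ∧ IsClopen (range f)

/-- The open embeddings all of whose points outside the image are isolated. Up to homeomorphism
these are the inclusions of a space into its disjoint union with a discrete space. -/
def discreteExtensions : MorphismProperty TopCat.{u} := fun _ _ f =>
  IsOpenEmbedding f ∧ ∀ y ∉ range f, IsOpen {y}

/-- The maps with dense image. -/
def dense : MorphismProperty TopCat.{u} := fun _ _ f => DenseRange f

/-- The maps whose image is contained in no proper open and closed subset. -/
def clopenDense : MorphismProperty TopCat.{u} := fun _ B f =>
  ∀ U : Set B, IsClopen U → range f ⊆ U → U = univ

/-- The maps whose fibres are T0 spaces. -/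
def t0Fibres : MorphismProperty TopCat.{u} := fun _ _ f =>
  ∀ x y, f x = f y → Inseparable x y → x = y

/-- The maps whose fibres are T1 spaces. -/
def t1Fibres : MorphismProperty TopCat.{u} := fun _ _ f =>
  ∀ x y, f x = f y → x ⤳ y → x = y

theorem discreteExtensions_le_clopenEmbeddings :
    discreteExtensions.{u} ≤ clopenEmbeddings := by
  rintro A B f ⟨hf, hy⟩
  refine ⟨hf.isEmbedding, isOpen_compl_iff.1 ?_, hf.isOpen_range⟩
  rw [← biUnion_of_singleton (range f)ᶜ]
  exact isOpen_biUnion hy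

theorem clopenDense_le_nonemptySource : clopenDense.{u} ≤ nonemptySource := by
  intro A B f hf hB
  by_contra hA
  have hrange : range f ⊆ ∅ := range_subset_iff.2 fun a => hA ⟨a⟩
  exact empty_ne_univ (hf ∅ isClopen_empty hrange)

theorem dense_le_clopenDense : dense.{u} ≤ clopenDense := fun _ _ _ hf _ hU hrange =>
  hU.isClosed.closure_eq.symm.trans (hf.mono hrange).closure_eq

theorem surjections_le_dense : surjections.{u} ≤ dense := fun _ _ _ hf => hf.denseRange

theorem quotients_le_surjections : quotients.{u} ≤ surjections := fun _ _ _ hf => hf.surjective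

theorem injections_le_t1Fibres : injections.{u} ≤ t1Fibres := fun _ _ _ hf _ _ h _ => hf h

theorem t1Fibres_le_t0Fibres : t1Fibres.{u} ≤ t0Fibres := fun _ _ _ hf x y h hxy =>
  hf x y h hxy.specializes

theorem closedEmbeddings_le_embeddings : closedEmbeddings.{u} ≤ embeddings := fun _ _ _ hf =>
  hf.isEmbedding

theorem embeddings_le_injections : embeddings.{u} ≤ injections := fun _ _ _ hf => hf.injective

end Classes

section TestSpaces

variable {P : MorphismProperty TopCat.{u}}

theorem isInducing_fst {Y Z : Type*} [TopologicalSpace Y] [TopologicalSpace Z]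
    [IndiscreteTopology Z] : IsInducing (Prod.fst : Y × Z → Y) :=
  ⟨by rw [instTopologicalSpaceProd, IndiscreteTopology.eq_top Z, induced_top, inf_top_eq]⟩

/-- The Sierpiński space, with open point `True`. -/
abbrev Sierp : Type u := ULift.{u} Prop

theorem isOpen_setOf_down : IsOpen {p : Sierp.{u} | p.down} :=
  continuous_Prop.1 continuous_uliftDown

theorem true_specializes (p : Sierp.{u}) : ⟨True⟩ ⤳ p := by
  have specializes_down : True ⤳ p.down := by by_cases h : p.down <;> simp [h, Specializes]
  exact specializes_down.map continuous_uliftUp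

/-- The map to the Sierpiński space that classifies an open set. -/
def toSierp {Z : Type u} [TopologicalSpace Z] (U : TopologicalSpace.Opens Z) : C(Z, Sierp.{u}) where
  toFun z := ⟨z ∈ U⟩
  continuous_toFun := continuous_uliftUp.comp (continuous_Prop.2 U.isOpen)

theorem llp_le_injections
    (hP : ∀ (Z : Type u) [Nonempty Z], P (TopCat.ofHom (toPoint (WithTopology Z ⊤)))) :
    P.llp ≤ injections := by
  intro A B f hf a a' h
  have : Nonempty A := ⟨a⟩
  obtain ⟨d, hd⟩ := exists_extension_of_llp hf (hP A)
    ⟨WithTopology.toTopology ⊤, continuous_of_indiscreteTopology⟩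
  exact WithTopology.toTopology_injective _ ((hd a).symm.trans ((congrArg d h).trans (hd a')))

theorem isInducing_of_llp (hP : P (TopCat.ofHom (toPoint Sierp))) {A B : TopCat.{u}} {f : A ⟶ B}
    (hf : P.llp f) : IsInducing f := by
  refine ⟨le_antisymm (continuous_iff_le_induced.1 f.hom.continuous) fun U hU => ?_⟩
  obtain ⟨d, hd⟩ := exists_extension_of_llp hf hP (toSierp ⟨U, hU⟩)
  refine ⟨_, isOpen_setOf_down.preimage d.continuous, ?_⟩
  ext a
  exact iff_of_eq (congrArg ULift.down (hd a))

theorem rlp_le_surjections (hP : emptyToPointClass ≤ P) : P.rlp ≤ surjections := by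
  intro X Y g hg y
  obtain ⟨d, -, hd⟩ := exists_lift_of_rlp (f := emptyToPoint.hom) hg (hP _ ⟨()⟩)
    ⟨PEmpty.elim, continuous_of_discreteTopology⟩ (.const _ y) fun x => x.elim
  exact ⟨d PUnit.unit, hd PUnit.unit⟩

theorem rlp_le_injections (hP : P (TopCat.ofHom (toPoint (ULift.{u} Bool)))) :
    P.rlp ≤ injections := by
  intro X Y g hg x x' h
  exact apply_eq_of_rlp hg hP ⟨fun z => bif z.down then x else x', continuous_of_discreteTopology⟩
    (g x) (by rintro ⟨_ | _⟩; exacts [h.symm, rfl]) ⟨true⟩ ⟨false⟩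

theorem rlp_le_t0Fibres (hP : P (TopCat.ofHom (toPoint (WithTopology (ULift.{u} Bool) ⊤)))) :
    P.rlp ≤ t0Fibres := by
  intro X Y g hg x x' h hxx'
  have continuous_t : Continuous fun z : WithTopology (ULift.{u} Bool) ⊤ =>
      bif z.ofTopology.down then x else x' := by
    refine SeparationQuotient.isInducing_mk.continuous_iff.2
      (continuous_const.congr (f := fun _ => SeparationQuotient.mk x) fun z => ?_)
    obtain ⟨⟨_ | _⟩⟩ := z
    exacts [SeparationQuotient.mk_eq_mk.2 hxx', rfl]
  exact apply_eq_of_rlp hg hP ⟨_, continuous_t⟩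
    (g x) (by rintro ⟨⟨_ | _⟩⟩; exacts [h.symm, rfl]) (.toTopology _ ⟨true⟩) (.toTopology _ ⟨false⟩)

theorem rlp_le_t1Fibres (hP : P (TopCat.ofHom (toPoint Sierp))) : P.rlp ≤ t1Fibres := by
  classical
  intro X Y g hg x x' h hxx'
  have continuous_t : Continuous ({p : Sierp.{u} | p.down}.piecewise (fun _ => x) fun _ => x') :=
    isOpen_setOf_down.continuous_piecewise_of_specializes continuous_const continuous_const
      fun _ => hxx'
  simpa using apply_eq_of_rlp hg hP ⟨_, continuous_t⟩ (g x)
    (fun p => by by_cases hp : p.down <;> simp [Set.piecewise, hp, h]) ⟨True⟩ ⟨False⟩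

theorem toPoint_mem_surjections (Z : Type u) [TopologicalSpace Z] [Nonempty Z] :
    surjections (TopCat.ofHom (toPoint Z)) :=
  fun _ => ⟨Classical.arbitrary Z, rfl⟩

theorem toPoint_mem_inducingSurjections (Z : Type u) [Nonempty Z] :
    inducingSurjections (TopCat.ofHom (toPoint (WithTopology Z ⊤))) :=
  ⟨toPoint_mem_surjections _, ⟨(IndiscreteTopology.eq_top _).trans induced_const.symm⟩⟩

theorem toPoint_mem_genericallySplit {Z : Type u} [TopologicalSpace Z] {z₀ : Z}
    (h : ∀ z, z₀ ⤳ z) : genericallySplit (TopCat.ofHom (toPoint Z)) :=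
  ⟨.const _ z₀, fun _ => rfl, h⟩

end TestSpaces

section Split

theorem emptyToPointClass_llp : emptyToPointClass.{u}.llp = nonemptySource := by
  ext A B f
  refine (MorphismProperty.llp_ofHoms_iff_hasLiftingProperty Unit f emptyToPoint).trans
    ((hasLiftingProperty_iff f emptyToPoint).trans ⟨fun h hB => ?_, fun h t b _ => ?_⟩)
  · by_contra hA
    rw [not_nonempty_iff] at hA
    obtain ⟨d, -, -⟩ := h ⟨hA.elim, continuous_of_const fun a => hA.elim a⟩ (toPoint B) hA.elim
    exact hB.elim fun y => (d y).elim
  · have hB : IsEmpty B := not_nonempty_iff.1 fun hB => (h hB).elim fun a => (t a).elim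
    exact ⟨⟨hB.elim, continuous_of_const fun y => hB.elim y⟩, fun a => (t a).elim, hB.elim⟩

theorem nonemptySource_rlp : nonemptySource.{u}.rlp = emptySourceOrIso := by
  refine le_antisymm (fun X Y g hg => ?_) fun X Y g hg => ?_
  · refine (isEmpty_or_nonempty X).imp_right fun hX => ?_
    exact isIso_of_hasLiftingProperty_self (hg g fun _ => hX)
  · rcases hg with hX | hg
    · refine fun A B f hf => (hasLiftingProperty_iff f g).2 fun t b _ => ?_
      have hB : IsEmpty B := not_nonempty_iff.1 fun hB => (hf hB).elim fun a => hX.elim (t a)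
      exact ⟨⟨hB.elim, continuous_of_const fun y => hB.elim y⟩, fun a => hX.elim (t a), hB.elim⟩
    · exact isomorphisms_le_rlp _ g hg

theorem isLiftingPair_nonemptySource_emptySourceOrIso :
    IsLiftingPair nonemptySource.{u} emptySourceOrIso :=
  .of_llp_eq emptyToPointClass_llp nonemptySource_rlp

theorem emptySourceOrIso_rlp : emptySourceOrIso.{u}.rlp = split := by
  refine le_antisymm (fun X Y g hg => ?_) ?_
  · obtain ⟨s, -, hs⟩ := exists_lift_of_rlp (Z := PEmpty) (W := Y) hg
      (f := ⟨PEmpty.elim, continuous_of_discreteTopology⟩) (.inl inferInstance)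
      ⟨PEmpty.elim, continuous_of_discreteTopology⟩ (.id Y) fun a => a.elim
    exact ⟨s, hs⟩
  · rintro X Y g ⟨s, hs⟩ A B f (hA | hf)
    · exact (hasLiftingProperty_iff f g).2 fun _ b _ =>
        ⟨s.comp b, hA.elim, fun y => hs (b y)⟩
    · exact isomorphisms_le_llp split f hf g ⟨s, hs⟩

theorem split_llp : split.{u}.llp = clopenEmbeddings := by
  refine le_antisymm (fun A B f hf => ?_) fun A B f hf X Y g ⟨s, hs⟩ => ?_
  · obtain ⟨d, hdf, hd⟩ := exists_section_of_llp hf ⟨Sum.inl, continuous_inl (Y := B)⟩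
      (p := ⟨Sum.elim f id, f.hom.continuous.sumElim continuous_id⟩)
      ⟨⟨Sum.inr, continuous_inr⟩, fun _ => rfl⟩ fun _ => rfl
    refine ⟨isEmbedding_of_comp_eq .inl hdf, ?_⟩
    rw [range_eq_preimage_range hdf hd fun _ => rfl]
    exact ⟨isClosed_range_inl.preimage d.continuous, isOpen_range_inl.preimage d.continuous⟩
  · refine hasLiftingProperty_of_extend hf.1.injective fun t b _ =>
      ⟨s.comp b, fun y => hs (b y), ?_⟩
    exact continuous_extend_of_isClopen_range hf.1 hf.2 t.continuous
      fun y _ => (s.comp b).continuous.continuousAt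

theorem isLiftingPair_clopenEmbeddings_split : IsLiftingPair clopenEmbeddings.{u} split :=
  .of_rlp_eq emptySourceOrIso_rlp split_llp

theorem split_rlp : split.{u}.rlp = injections :=
  le_antisymm
    (rlp_le_injections ⟨.const _ ⟨true⟩, fun _ => rfl⟩)
    fun _ _ _ hg _ _ _ ⟨_, hs⟩ => hasLiftingProperty_of_leftInverse hs fun _ _ h => hg h

theorem clopenDense_le_clopenEmbeddings_llp : clopenDense.{u} ≤ clopenEmbeddings.llp :=
  fun _ _ _ hf _ _ _ hg => hasLiftingProperty_of_isEmbedding hg.1 fun b =>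
    hf _ (hg.2.preimage b.continuous)

end Split

section Injections

theorem injections_llp : injections.{u}.llp = quotients := by
  refine le_antisymm (fun A B f hf => ?_) fun A B f hf X Y g hg =>
    hasLiftingProperty_of_isQuotientMap hf fun _ h _ _ ha => hg (h ha)
  let p : C(Quotient (Setoid.ker f), B) := ⟨Setoid.kerLift f, f.hom.continuous.quotient_lift _⟩
  obtain ⟨s, -, hs⟩ := exists_section_of_llp hf ⟨Quotient.mk'', continuous_quotient_mk'⟩
    (p := p) (Setoid.kerLift_injective f) fun _ => rfl
  have hp : IsQuotientMap p := .of_inverse s.continuous p.continuous hs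
  exact hp.comp isQuotientMap_quotient_mk'

theorem isLiftingPair_quotients_injections : IsLiftingPair quotients.{u} injections :=
  .of_rlp_eq split_rlp injections_llp

theorem isLiftingPair_injections_inducingSurjections :
    IsLiftingPair injections.{u} inducingSurjections := by
  refine .of_le (fun A B f hf X Y g hg => ?_) (llp_le_injections fun Z _ =>
    toPoint_mem_inducingSurjections Z) fun X Y g hg => ⟨?_, ?_⟩
  · refine hasLiftingProperty_of_extend hf fun t b comm =>
      ⟨Function.surjInv hg.1 ∘ b, fun y => Function.surjInv_eq hg.1 (b y), ?_⟩
    exact hg.2.continuous_iff.2 (b.continuous.congr fun y =>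
      (apply_extend_eq hf comm (fun y => Function.surjInv_eq hg.1 (b y)) y).symm)
  · exact rlp_le_surjections (fun _ _ _ h => by obtain ⟨⟨⟩⟩ := h; exact fun x => x.elim) g hg
  · let i : C(X, Y × WithTopology X ⊤) :=
      ⟨fun x => (g x, .toTopology _ x), g.hom.continuous.prodMk continuous_of_indiscreteTopology⟩
    obtain ⟨r, hr, -⟩ := exists_retraction_of_rlp hg (i := i)
      (fun x x' h => WithTopology.toTopology_injective _ (congrArg Prod.snd h)) .fst fun _ => rfl
    have hi : IsEmbedding i := .of_leftInverse hr r.continuous i.continuous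
    exact isInducing_fst.comp hi.isInducing

theorem isLiftingPair_inducingSurjections_t0Fibres :
    IsLiftingPair inducingSurjections.{u} t0Fibres := by
  refine .of_le (fun A B f hf X Y g hg => ?_) (fun A B f hf => ⟨?_, ?_⟩)
    (rlp_le_t0Fibres (toPoint_mem_inducingSurjections _))
  · exact hasLiftingProperty_of_isQuotientMap (hf.2.isQuotientMap_of_surjective hf.1)
      fun t h a a' ha => hg _ _ (h ha) ((hf.2.inseparable_iff.1 (.of_eq ha)).map t.continuous)
  · exact range_eq_univ.1 <| eq_univ_of_llp_of_range_subset hf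
      (fun _ _ h _ => Subtype.val_injective h) Subset.rfl
  · exact isInducing_of_llp (fun _ _ _ h => h.eq) hf

theorem t0Fibres_rlp : t0Fibres.{u}.rlp = MorphismProperty.isomorphisms TopCat :=
  rlp_eq_isomorphisms <|
    (rlp_le_injections fun _ _ _ h => h.eq).trans
      (injections_le_t1Fibres.trans t1Fibres_le_t0Fibres)

theorem t1Fibres_rlp : t1Fibres.{u}.rlp = MorphismProperty.isomorphisms TopCat :=
  rlp_eq_isomorphisms <|
    (rlp_le_injections fun _ _ _ h => h.eq).trans injections_le_t1Fibres

end Injections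

section Surjections

theorem emptyToPointClass_rlp : emptyToPointClass.{u}.rlp = surjections := by
  refine le_antisymm (rlp_le_surjections le_rfl) ?_
  rintro X Y g hg _ _ _ ⟨⟨⟩⟩
  refine (hasLiftingProperty_iff emptyToPoint g).2 fun _ b _ => ?_
  obtain ⟨x, hx⟩ := hg (b PUnit.unit)
  exact ⟨.const _ x, fun a => a.elim, fun _ => hx⟩

theorem surjections_llp : surjections.{u}.llp = discreteExtensions := by
  refine le_antisymm (fun A B f hf => ?_) fun A B f hf X Y g hg => ?_
  -- A set-theoretic section suffices for surjectivity, so the second summand may be discrete.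
  · let p : C(A ⊕ WithDiscreteTopology B, B) :=
      ⟨Sum.elim f WithTopology.ofTopology,
        f.hom.continuous.sumElim continuous_of_discreteTopology⟩
    obtain ⟨s, hsf, hs⟩ := exists_section_of_llp hf
      ⟨Sum.inl, continuous_inl (Y := WithDiscreteTopology B)⟩ (p := p)
      (fun y => ⟨.inr (.toTopology _ y), rfl⟩) fun _ => rfl
    have range_eq : range f = s ⁻¹' range Sum.inl := range_eq_preimage_range hsf hs fun _ => rfl
    refine ⟨⟨isEmbedding_of_comp_eq .inl hsf, range_eq ▸ isOpen_range_inl.preimage s.continuous⟩,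
      fun y hy => ?_⟩
    rw [← hs.injective.preimage_image {y}, image_singleton]
    refine IsOpen.preimage s.continuous ?_
    rcases h : s y with a | z
    · exact absurd ⟨a, h.symm⟩ (range_eq ▸ hy)
    · rw [← image_singleton]
      exact isOpenMap_inr _ (isOpen_discrete _)
  · obtain ⟨hemb, hclopen⟩ := discreteExtensions_le_clopenEmbeddings f hf
    exact hasLiftingProperty_of_extend hemb.injective fun t b _ =>
      ⟨Function.surjInv hg ∘ b, fun y => Function.surjInv_eq hg (b y),
        continuous_extend_of_isClopen_range hemb hclopen t.continuous fun y hy => by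
          rw [ContinuousAt, (isOpen_singleton_iff_nhds_eq_pure y).1 (hf.2 y hy)]
          exact tendsto_pure_nhds _ _⟩

theorem isLiftingPair_discreteExtensions_surjections :
    IsLiftingPair discreteExtensions.{u} surjections :=
  .of_rlp_eq emptyToPointClass_rlp surjections_llp

theorem llp_le_clopenDense {P : MorphismProperty TopCat.{u}}
    (hP : P (TopCat.ofHom (.const PUnit.{u + 1} (ULift.up.{u} true)))) : P.llp ≤ clopenDense := by
  intro A B f hf U hU hrange
  obtain ⟨d, -, hd⟩ := exists_lift_of_llp hf hP (toPoint A)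
    ⟨_, continuous_uliftUp.comp ((continuous_boolIndicator_iff_isClopen U).2 hU)⟩
    fun a => congrArg ULift.up ((mem_iff_boolIndicator U (f a)).1 (hrange ⟨a, rfl⟩)).symm
  exact eq_univ_of_forall fun y =>
    (mem_iff_boolIndicator U y).2 (congrArg ULift.down (hd y)).symm

theorem discreteExtensions_llp_le_clopenDense : discreteExtensions.{u}.llp ≤ clopenDense :=
  llp_le_clopenDense
    ⟨.of_continuous_injective_isOpenMap continuous_const (fun _ _ _ => rfl)
      fun _ _ => isOpen_discrete _, fun _ _ => isOpen_discrete _⟩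

theorem clopenEmbeddings_llp : clopenEmbeddings.{u}.llp = clopenDense :=
  ((MorphismProperty.antitone_llp discreteExtensions_le_clopenEmbeddings).trans
    discreteExtensions_llp_le_clopenDense).antisymm clopenDense_le_clopenEmbeddings_llp

theorem isLiftingPair_clopenDense_rlp : IsLiftingPair clopenDense.{u} clopenDense.rlp :=
  .of_llp_eq clopenEmbeddings_llp rfl

theorem discreteExtensions_llp : discreteExtensions.{u}.llp = clopenDense :=
  discreteExtensions_llp_le_clopenDense.antisymm <|
    clopenDense_le_clopenEmbeddings_llp.trans
      (MorphismProperty.antitone_llp discreteExtensions_le_clopenEmbeddings)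

theorem nonemptySource_llp : nonemptySource.{u}.llp = MorphismProperty.isomorphisms TopCat :=
  llp_eq_isomorphisms <|
    (llp_le_clopenDense fun _ => ⟨PUnit.unit⟩).trans clopenDense_le_nonemptySource

end Surjections

section Embeddings

theorem isLiftingPair_surjections_embeddings : IsLiftingPair surjections.{u} embeddings := by
  refine .of_le (fun A B f hf X Y g hg => ?_) (fun A B f hf => ?_) fun X Y g hg => ?_
  · exact hasLiftingProperty_of_isEmbedding hg fun b hb => by
      rwa [Function.Surjective.range_eq hf, univ_subset_iff] at hb
  · exact range_eq_univ.1 (eq_univ_of_llp_of_range_subset hf .subtypeVal Subset.rfl)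
  · exact (isEmbedding_and_range_eq_of_rlp hg mem_range_self
      (rangeFactorization_surjective (f := g))).1

theorem isLiftingPair_dense_closedEmbeddings : IsLiftingPair dense.{u} closedEmbeddings := by
  refine .of_le (fun A B f hf X Y g hg => ?_) (fun A B f hf => ?_) fun X Y g hg => ?_
  · refine hasLiftingProperty_of_isEmbedding hg.isEmbedding fun b hb => ?_
    exact (hg.isClosed_range.preimage b.continuous).closure_eq.symm.trans (hf.mono hb).closure_eq
  · exact dense_iff_closure_eq.2 <| eq_univ_of_llp_of_range_subset hf
      isClosed_closure.isClosedEmbedding_subtypeVal subset_closure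
  · obtain ⟨isEmbedding_g, range_eq⟩ := isEmbedding_and_range_eq_of_rlp hg
      (fun x => subset_closure (mem_range_self x))
      (IsInducing.subtypeVal.dense_iff.2 fun y => by
        rw [← range_comp]
        exact y.2)
    exact ⟨isEmbedding_g, range_eq ▸ isClosed_closure⟩

theorem dense_llp : dense.{u}.llp = MorphismProperty.isomorphisms TopCat := by
  refine llp_eq_isomorphisms fun A B f hf => ?_
  have isOpen_range : IsOpen (range f) :=
    (surjections_llp.le f (MorphismProperty.antitone_llp surjections_le_dense f hf)).1.isOpen_range
  have dense_true : dense (TopCat.ofHom (.const PUnit.{u + 1} (⟨True⟩ : Sierp.{u}))) := fun p =>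
    range_const (ι := PUnit) ▸ (true_specializes p).mem_closure
  obtain ⟨d, -, hd⟩ := exists_lift_of_llp hf dense_true (toPoint A) (toSierp ⟨_, isOpen_range⟩)
    fun a => congrArg ULift.up (eq_true ⟨a, rfl⟩).symm
  exact Function.Surjective.denseRange fun y => of_eq_true (congrArg ULift.down (hd y)).symm

theorem clopenDense_llp : clopenDense.{u}.llp = MorphismProperty.isomorphisms TopCat :=
  ((MorphismProperty.antitone_llp dense_le_clopenDense).trans dense_llp.le).antisymm
    (isomorphisms_le_llp _)

theorem inducingSurjections_le_embeddings_rlp : inducingSurjections.{u} ≤ embeddings.rlp :=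
  isLiftingPair_injections_inducingSurjections.rlp_eq.ge.trans
    (MorphismProperty.antitone_rlp embeddings_le_injections)

theorem toPoint_sierp_mem_embeddings_rlp :
    embeddings.{u}.rlp (TopCat.ofHom (toPoint Sierp)) := by
  intro A B f hf
  refine (hasLiftingProperty_iff f _).2 fun t b _ => ?_
  obtain ⟨U, hU, preimage_eq⟩ :=
    hf.isOpen_iff.1 (isOpen_setOf_down.preimage t.continuous)
  exact ⟨toSierp ⟨U, hU⟩, fun a => congrArg ULift.up (congrFun preimage_eq a), fun _ => rfl⟩

theorem isLiftingPair_embeddings_rlp : IsLiftingPair embeddings.{u} embeddings.rlp :=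
  .of_le (MorphismProperty.le_llp_rlp _) (fun _ _ _ hf =>
    ⟨isInducing_of_llp toPoint_sierp_mem_embeddings_rlp hf,
      llp_le_injections (fun Z _ =>
        inducingSurjections_le_embeddings_rlp _ (toPoint_mem_inducingSurjections Z)) _ hf⟩) le_rfl

end Embeddings

section GenericallySplit

theorem toPoint_sierp_mem_genericallySplit : genericallySplit.{u} (TopCat.ofHom (toPoint Sierp)) :=
  toPoint_mem_genericallySplit true_specializes

theorem inducingSurjections_le_genericallySplit :
    inducingSurjections.{u} ≤ genericallySplit := by
  rintro A B f ⟨hf, hind⟩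
  have hs : Function.LeftInverse f (Function.surjInv hf) := Function.surjInv_eq hf
  exact ⟨⟨_, hind.continuous_iff.2 (continuous_id.congr fun y => (hs y).symm)⟩, hs, fun x =>
    hind.specializes_iff.1 (specializes_of_eq (hs (f x)))⟩

theorem genericallySplit_rlp : genericallySplit.{u}.rlp = t1Fibres :=
  (rlp_le_t1Fibres toPoint_sierp_mem_genericallySplit).antisymm
    fun _ _ _ hg _ _ _ ⟨_, hs, hgen⟩ => hasLiftingProperty_of_leftInverse hs fun t a h =>
      hg _ _ h ((hgen a).map t.continuous)

theorem isLiftingPair_t1Fibres_llp : IsLiftingPair t1Fibres.{u}.llp t1Fibres :=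
  .of_rlp_eq genericallySplit_rlp rfl

theorem closedEmbeddings_le_genericallySplit_llp :
    closedEmbeddings.{u} ≤ genericallySplit.llp := by
  intro A B f hf X Y g ⟨s, hs, hgen⟩
  refine hasLiftingProperty_of_extend hf.injective fun t b comm =>
    ⟨s.comp b, fun y => hs (b y), ?_⟩
  refine continuous_extend hf t.continuous
    (fun y _ => (s.comp b).continuous.continuousAt) fun a => ?_
  have specializes_t : s (b (f a)) ⤳ t a := comm a ▸ hgen (t a)
  exact ((s.comp b).continuous.tendsto' _ _ rfl |>.mono_left nhdsWithin_le_nhds).mono_right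
    specializes_t

theorem isClosed_range_of_genericallySplit_llp {A B : TopCat.{u}} {f : A ⟶ B}
    (hf : genericallySplit.llp f) : IsClosed (range f) := by
  let Z : Set (B × Sierp.{u}) := {z | z.2.down ∨ z.1 ∈ range f}
  let p : C(Z, B) := ⟨fun z => z.1.1, by fun_prop⟩
  let s : C(B, Z) := ⟨fun y => ⟨(y, ⟨True⟩), .inl trivial⟩, by fun_prop⟩
  have hp : genericallySplit (TopCat.ofHom p) :=
    ⟨s, fun _ => rfl, fun z => (subtype_specializes_iff _ _).2 <|
      (specializes_rfl (x := z.1.1)).prod (true_specializes z.1.2)⟩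
  obtain ⟨d, hdf, hd⟩ := exists_section_of_llp hf
    ⟨fun a => ⟨(f a, ⟨False⟩), .inr ⟨a, rfl⟩⟩, by fun_prop⟩ hp fun _ => rfl
  have range_eq : (range f)ᶜ = (fun y => (d y).1.2) ⁻¹' {p | p.down} := by
    refine Subset.antisymm (fun y hy => (d y).2.resolve_right ?_) fun y hy => ?_
    · rwa [show (d y).1.1 = y from hd y]
    · rintro ⟨a, rfl⟩
      exact (congrArg (fun z : Z => z.1.2.down) (hdf a)).mp hy
  rw [← isOpen_compl_iff, range_eq]
  exact isOpen_setOf_down.preimage (by fun_prop)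

theorem genericallySplit_llp : genericallySplit.{u}.llp = closedEmbeddings :=
  le_antisymm (fun _ _ _ hf =>
    ⟨⟨isInducing_of_llp toPoint_sierp_mem_genericallySplit hf,
      llp_le_injections (fun Z _ =>
        inducingSurjections_le_genericallySplit _ (toPoint_mem_inducingSurjections Z)) _ hf⟩,
      isClosed_range_of_genericallySplit_llp hf⟩)
    closedEmbeddings_le_genericallySplit_llp

end GenericallySplit

section Slices

-- Cofinite filters fail the last property for infinite `ι`; it needs a regular cardinal above `ι`.
theorem exists_free_filter (ι : Type u) : ∃ (K : Type u) (F : Filter K), F.NeBot ∧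
    (∀ k, ∀ᶠ k' in F, k' ≠ k) ∧
    ∀ p : K → ι → Prop, (∀ i, ∀ᶠ k in F, p k i) → ∀ᶠ k in F, ∀ i, p k i := by
  let c : Cardinal.{u} := max (Cardinal.mk ι) Cardinal.aleph0
  have hc : (Order.succ c).IsRegular := Cardinal.isRegular_succ (le_max_right _ _)
  refine ⟨(Order.succ c).out, cocardinal _ hc, ?_, eventually_cocardinal_ne, fun p hp => ?_⟩
  · rw [neBot_iff, ne_eq, ← empty_mem_iff_bot, mem_cocardinal, compl_empty, Cardinal.mk_univ,
      Cardinal.mk_out]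
    exact lt_irrefl _
  · exact (eventually_cardinal_forall
      ((le_max_left _ _).trans_lt (Order.lt_succ c : c < Order.succ c))).2 hp

/-- The disjoint union of `X` and of copies of `Y` indexed by `K`, topologized so that the copies
of `h x` converge to `x` along `F`. -/
inductive Slices {X Y K : Type u} (h : X → Y) (F : Filter K) : Type u
  | base (x : X)
  | copy (k : K) (y : Y)

namespace Slices

variable {X Y K : Type u} [TopologicalSpace X] [TopologicalSpace Y] {F : Filter K}

instance (h : X → Y) : TopologicalSpace (Slices h F) where
  IsOpen W := IsOpen (base ⁻¹' W) ∧ (∀ k, IsOpen (copy k ⁻¹' W)) ∧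
    ∀ x, base x ∈ W → ∀ᶠ k in F, copy k (h x) ∈ W
  isOpen_univ := ⟨isOpen_univ, fun _ => isOpen_univ, fun _ _ => .of_forall fun _ => trivial⟩
  isOpen_inter _ _ hV hW := ⟨hV.1.inter hW.1, fun k => (hV.2.1 k).inter (hW.2.1 k),
    fun x hx => (hV.2.2 x hx.1).and (hW.2.2 x hx.2)⟩
  isOpen_sUnion S hS := by
    simp only [preimage_sUnion]
    exact ⟨isOpen_biUnion fun W hW => (hS W hW).1,
      fun k => isOpen_biUnion fun W hW => (hS W hW).2.1 k,
      fun x ⟨W, hW, hx⟩ => ((hS W hW).2.2 x hx).mono fun k hk => ⟨W, hW, hk⟩⟩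

theorem isOpen_iff {h : X → Y} {W : Set (Slices h F)} :
    IsOpen W ↔ IsOpen (base ⁻¹' W) ∧ (∀ k, IsOpen (copy k ⁻¹' W)) ∧
      ∀ x, base x ∈ W → ∀ᶠ k in F, copy k (h x) ∈ W :=
  Iff.rfl

variable (F) in
/-- The map to `Y` that is `h` on `X` and the identity on each copy of `Y`. -/
def proj (h : C(X, Y)) : C(Slices h F, Y) where
  toFun
    | base x => h x
    | copy _ y => y
  continuous_toFun := ⟨fun _ hU => isOpen_iff.2
    ⟨hU.preimage h.continuous, fun _ => hU, fun _ hx => .of_forall fun _ => hx⟩⟩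

theorem isEmbedding_base (h : X → Y) : IsEmbedding (base : X → Slices h F) := by
  have continuous_base : Continuous (base : X → Slices h F) := ⟨fun _ hW => hW.1⟩
  have injective_base : Function.Injective (base : X → Slices h F) := fun _ _ => base.inj
  refine ⟨⟨(continuous_iff_le_induced.1 continuous_base).antisymm fun U hU => ?_⟩, injective_base⟩
  have copy_mem : ∀ k y, (copy k y : Slices h F) ∈ (base '' Uᶜ)ᶜ := fun k y ⟨_, _, hx⟩ => by
    cases hx
  have preimage_eq : base ⁻¹' (base '' Uᶜ : Set (Slices h F))ᶜ = U := by
    rw [preimage_compl, preimage_image_eq _ injective_base, compl_compl]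
  exact ⟨(base '' Uᶜ)ᶜ, isOpen_iff.2 ⟨preimage_eq.symm ▸ hU,
    fun k => by rw [eq_univ_of_forall (s := copy k ⁻¹' _) (copy_mem k)]; exact isOpen_univ,
    fun x _ => .of_forall fun k => copy_mem k (h x)⟩, preimage_eq⟩

theorem continuous_copy (h : X → Y) (k : K) : Continuous (copy k : Y → Slices h F) :=
  ⟨fun _ hW => hW.2.1 k⟩

theorem isClopen_range_copy (hF : ∀ k, ∀ᶠ k' in F, k' ≠ k) (h : X → Y) (k : K) :
    IsClopen (range (copy k : Y → Slices h F)) := by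
  have copy_mem_iff : ∀ k' y, (copy k' y : Slices h F) ∈ range (copy k) ↔ k' = k := fun k' y =>
    ⟨fun ⟨_, hy⟩ => (copy.inj hy).1.symm, fun hk => ⟨y, hk ▸ rfl⟩⟩
  have preimage_base : base ⁻¹' (range (copy k) : Set (Slices h F)) = ∅ :=
    eq_empty_of_forall_notMem fun x ⟨_, hx⟩ => by cases hx
  have preimage_copy : ∀ k', copy k' ⁻¹' (range (copy k) : Set (Slices h F)) = {_y | k' = k} :=
    fun k' => Set.ext (copy_mem_iff k')
  refine ⟨⟨isOpen_iff.2 ⟨?_, fun k' => ?_, fun x _ => ?_⟩⟩, isOpen_iff.2 ⟨?_, fun k' => ?_, ?_⟩⟩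
  · simp only [preimage_compl, preimage_base, compl_empty, isOpen_univ]
  · rw [preimage_compl, preimage_copy]
    exact isOpen_const (p := ¬ k' = k)
  · exact (hF k).mono fun k' hk' => (copy_mem_iff k' (h x)).not.2 hk'
  · simp only [preimage_base, isOpen_empty]
  · rw [preimage_copy]
    exact isOpen_const
  · rintro x ⟨_, ⟨⟩⟩

theorem base_mem_clopenDense_rlp (hF : ∀ k, ∀ᶠ k' in F, k' ≠ k) (h : X → Y) :
    clopenDense.rlp (TopCat.ofHom
      (⟨base, (isEmbedding_base h).continuous⟩ : C(X, Slices h F))) := by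
  intro A B f hf
  refine hasLiftingProperty_of_isEmbedding (isEmbedding_base h) fun b hb => ?_
  refine eq_univ_of_forall fun y => ?_
  rcases hy : b y with x | ⟨k, z⟩
  · exact ⟨x, hy.symm⟩
  have eq_univ : b ⁻¹' (range (copy k))ᶜ = univ :=
    hf _ ((isClopen_range_copy hF h k).compl.preimage b.continuous) <|
      hb.trans (preimage_mono (range_subset_iff.2 fun x ⟨z, hz⟩ => by cases hz))
  exact absurd ⟨z, hy.symm⟩ (eq_univ_iff_forall.1 eq_univ y)

end Slices

theorem clopenDense_rlp_rlp_le_genericallySplit :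
    clopenDense.{u}.rlp.rlp ≤ genericallySplit := by
  intro X Y h hh
  obtain ⟨K, F, hF, free, eventually_forall⟩ := exists_free_filter (X × TopologicalSpace.Opens X)
  obtain ⟨d, hd, hhd⟩ := exists_retraction_of_rlp hh (Slices.base_mem_clopenDense_rlp free h)
    (Slices.proj F h.hom) fun _ => rfl
  have eventually_mem : ∀ i : X × TopologicalSpace.Opens X, ∀ᶠ k in F,
      i.1 ∈ i.2 → d (.copy k (h i.1)) ∈ i.2 := fun ⟨x, U⟩ => by
    by_cases hx : x ∈ U
    · have base_mem : d (.base x) ∈ U := mem_of_eq_of_mem (hd x) hx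
      exact ((U.isOpen.preimage d.continuous).2.2 x base_mem).mono fun _ hk _ => hk
    · exact .of_forall fun _ hx' => absurd hx' hx
  obtain ⟨k, hk⟩ := (eventually_forall _ eventually_mem).exists
  exact ⟨d.comp ⟨_, Slices.continuous_copy h k⟩, fun y => hhd (.copy k y), fun x =>
    specializes_iff_forall_open.2 fun U hU hx => hk (x, ⟨U, hU⟩) hx⟩

theorem closedEmbeddings_rlp_le_clopenDense_rlp_rlp :
    closedEmbeddings.{u}.rlp ≤ clopenDense.rlp.rlp :=
  MorphismProperty.antitone_rlp <|
    (MorphismProperty.antitone_rlp dense_le_clopenDense).trans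
      isLiftingPair_dense_closedEmbeddings.rlp_eq.le

theorem isLiftingPair_closedEmbeddings_genericallySplit :
    IsLiftingPair closedEmbeddings.{u} genericallySplit :=
  .of_le closedEmbeddings_le_genericallySplit_llp genericallySplit_llp.le <|
    closedEmbeddings_rlp_le_clopenDense_rlp_rlp.trans clopenDense_rlp_rlp_le_genericallySplit

theorem clopenDense_rlp_rlp : clopenDense.{u}.rlp.rlp = genericallySplit :=
  clopenDense_rlp_rlp_le_genericallySplit.antisymm <|
    isLiftingPair_closedEmbeddings_genericallySplit.rlp_eq.ge.trans
      closedEmbeddings_rlp_le_clopenDense_rlp_rlp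

theorem embeddings_rlp_rlp : embeddings.{u}.rlp.rlp = t1Fibres :=
  (rlp_le_t1Fibres toPoint_sierp_mem_embeddings_rlp).antisymm <|
    genericallySplit_rlp.ge.trans <| MorphismProperty.antitone_rlp <|
      (MorphismProperty.antitone_rlp closedEmbeddings_le_embeddings).trans
        isLiftingPair_closedEmbeddings_genericallySplit.rlp_eq.le

end Slices

section Sheets

/-- For `f : A → B`, the disjoint union of `A`, of countably many copies of `B` (the sheets) and of
one further copy of `B` (the cone points), topologized so that a neighbourhood of the cone point
over `b` contains the whole fibre over `b` and, for `c` close to `b`, almost all sheets over `c`. -/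
inductive Sheets {A B : Type u} (f : A → B) : Type u
  | base (a : A)
  | sheet (b : B) (n : ℕ)
  | cone (b : B)

namespace Sheets

variable {A B : Type u} [TopologicalSpace A] [TopologicalSpace B]

/-- The map to `B` that is `f` on `A` and the identity on each copy of `B`. -/
def proj {f : A → B} : Sheets f → B
  | base a => f a
  | sheet b _ => b
  | cone b => b

instance (f : A → B) : TopologicalSpace (Sheets f) where
  IsOpen W := IsOpen (base ⁻¹' W) ∧ ∀ b, cone b ∈ W → (∀ z, proj z = b → z ∈ W) ∧
    ∀ᶠ c in 𝓝 b, ∀ᶠ n in cofinite, sheet c n ∈ W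
  isOpen_univ := ⟨isOpen_univ, fun _ _ => ⟨fun _ _ => trivial, .of_forall fun _ =>
    .of_forall fun _ => trivial⟩⟩
  isOpen_inter _ _ hV hW := ⟨hV.1.inter hW.1, fun b hb =>
    ⟨fun z hz => ⟨(hV.2 b hb.1).1 z hz, (hW.2 b hb.2).1 z hz⟩,
      ((hV.2 b hb.1).2.and (hW.2 b hb.2).2).mono fun _ hc => hc.1.and hc.2⟩⟩
  isOpen_sUnion S hS := by
    rw [preimage_sUnion]
    exact ⟨isOpen_biUnion fun W hW => (hS W hW).1, fun b ⟨W, hW, hb⟩ =>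
      ⟨fun z hz => ⟨W, hW, ((hS W hW).2 b hb).1 z hz⟩,
        ((hS W hW).2 b hb).2.mono fun c hc => hc.mono fun n hn => ⟨W, hW, hn⟩⟩⟩

theorem isOpen_iff {f : A → B} {W : Set (Sheets f)} :
    IsOpen W ↔ IsOpen (base ⁻¹' W) ∧ ∀ b, cone b ∈ W → (∀ z, proj z = b → z ∈ W) ∧
      ∀ᶠ c in 𝓝 b, ∀ᶠ n in cofinite, sheet c n ∈ W :=
  Iff.rfl

theorem isOpenEmbedding_base (f : A → B) : IsOpenEmbedding (base : A → Sheets f) := by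
  have injective_base : Function.Injective (base : A → Sheets f) := fun _ _ => base.inj
  refine .of_continuous_injective_isOpenMap ⟨fun _ hW => hW.1⟩ injective_base fun U hU => ?_
  exact isOpen_iff.2 ⟨by rwa [preimage_image_eq _ injective_base], fun b ⟨_, _, h⟩ => by cases h⟩

theorem specializes_cone {f : A → B} (z : Sheets f) : z ⤳ cone (proj z) :=
  specializes_iff_forall_open.2 fun _ hW hz => (hW.2 _ hz).1 z rfl

theorem continuous_proj {f : A → B} (hf : Continuous f) : Continuous (proj : Sheets f → B) := by
  refine ⟨fun U hU => isOpen_iff.2 ⟨hU.preimage hf, fun b hb => ⟨fun z hz => ?_,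
    (hU.eventually_mem hb).mono fun _ hc => .of_forall fun _ => hc⟩⟩⟩
  rwa [mem_preimage, hz]

theorem isQuotientMap_proj {f : A → B} (hf : Continuous f) :
    IsQuotientMap (proj : Sheets f → B) := by
  refine ⟨isCoinducing_iff.2 fun U => ⟨fun hU => isOpen_iff_mem_nhds.2 fun b hb => ?_,
    fun hU => hU.preimage (continuous_proj hf)⟩, fun b => ⟨cone b, rfl⟩⟩
  exact ((isOpen_iff.1 hU).2 b hb).2.mono fun c hc => hc.exists.choose_spec

theorem proj_mem_t1Fibres_llp {f : A → B} (hf : Continuous f) :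
    t1Fibres.llp (TopCat.ofHom
      (⟨proj, continuous_proj hf⟩ : C(Sheets f, B))) := by
  intro X Y g hg
  refine hasLiftingProperty_of_isQuotientMap (isQuotientMap_proj hf) fun t h z z' hz => ?_
  have eq_cone : ∀ z, t z = t (cone (proj z)) := fun z =>
    hg _ _ (h rfl) ((specializes_cone z).map t.continuous)
  exact (eq_cone z).trans ((congrArg (t ∘ cone) hz).trans (eq_cone z').symm)

theorem isOpen_singleton_of_section {f : A → B} {s : C(B, Sheets f)}
    (hs : Function.LeftInverse proj s) {c : B} (hc : c ∉ range f) : IsOpen {c} := by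
  let W : Set (Sheets f) := {z | proj z = c} ∪ {z | ∃ b n, z = sheet b n ∧ z ≠ s b}
  have isOpen_W : IsOpen W := by
    refine isOpen_iff.2 ⟨?_, ?_⟩
    · have preimage_eq : base ⁻¹' W = ∅ := by
        refine eq_empty_of_forall_notMem fun a ha => ?_
        obtain h | ⟨_, _, ⟨⟩, _⟩ := ha
        exact hc ⟨a, h⟩
      exact preimage_eq ▸ isOpen_empty
    · rintro b (rfl | ⟨_, _, ⟨⟩, _⟩)
      refine ⟨fun z hz => .inl hz, .of_forall fun y => ?_⟩
      have injective_sheet : Function.Injective (sheet y : ℕ → Sheets f) :=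
        fun _ _ h => (sheet.inj h).2
      exact (injective_sheet.tendsto_cofinite.eventually (eventually_cofinite_ne (s y))).mono
        fun n hn => .inr ⟨y, n, rfl, hn⟩
  have preimage_eq : s ⁻¹' W = {c} := by
    refine Subset.antisymm ?_ (singleton_subset_iff.2 (.inl (hs c)))
    rintro y (hy | ⟨b, n, hy, hne⟩)
    · exact (hs y).symm.trans hy
    · have y_eq_b : y = b := (hs y).symm.trans (congrArg proj hy)
      exact absurd (congrArg s y_eq_b) hne
  exact preimage_eq ▸ isOpen_W.preimage s.continuous

end Sheets

theorem t1Fibres_llp_llp : t1Fibres.{u}.llp.llp = discreteExtensions := by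
  refine le_antisymm (fun A B f hf => ?_) ?_
  · obtain ⟨s, hsf, hs⟩ := exists_section_of_llp hf
      ⟨Sheets.base, (Sheets.isOpenEmbedding_base f).continuous⟩
      (Sheets.proj_mem_t1Fibres_llp f.hom.continuous) fun _ => rfl
    have isOpen_range : IsOpen (range f) := by
      rw [range_eq_preimage_range hsf hs fun _ => rfl]
      exact (Sheets.isOpenEmbedding_base f).isOpen_range.preimage s.continuous
    exact ⟨⟨isEmbedding_of_comp_eq (Sheets.isOpenEmbedding_base f).isEmbedding hsf, isOpen_range⟩,
      fun y hy => Sheets.isOpen_singleton_of_section hs hy⟩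
  · exact surjections_llp.ge.trans <| MorphismProperty.antitone_llp <|
      (MorphismProperty.antitone_llp injections_le_t1Fibres).trans <|
        injections_llp.le.trans quotients_le_surjections

theorem quotients_llp : quotients.{u}.llp = discreteExtensions :=
  le_antisymm
    ((MorphismProperty.antitone_llp <|
      (MorphismProperty.antitone_llp injections_le_t1Fibres).trans injections_llp.le).trans
        t1Fibres_llp_llp.le)
    (surjections_llp.ge.trans (MorphismProperty.antitone_llp quotients_le_surjections))

end Sheets

section SchreierGraph

/-- The explicit description of the class attached to a vertex, independent of the word that names
it. The classes at `rllr`, `rrr` and `rrrrl` are left as orthogonals of explicit classes. -/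
def Vertex.describe : Vertex → MorphismProperty TopCat.{u}
  | .l => nonemptySource
  | .ll => .isomorphisms TopCat
  | .lll => ⊤
  | .lr => emptySourceOrIso
  | .lrr => split
  | .lrrl => clopenEmbeddings
  | .lrrr => injections
  | .lrrrl => quotients
  | .lrrrr => inducingSurjections
  | .lrrrrr => t0Fibres
  | .r => surjections
  | .rl => discreteExtensions
  | .rll => clopenDense
  | .rllr => clopenDense.rlp
  | .rllrr => genericallySplit
  | .rllrrl => closedEmbeddings
  | .rllrrll => dense
  | .rr => embeddings
  | .rrr => embeddings.rlp
  | .rrrr => t1Fibres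
  | .rrrrl => t1Fibres.llp

theorem Vertex.llp_describe (x : Vertex) : x.describe.llp = x.left.describe.{u} :=
  match x with
  | .l => nonemptySource_llp
  | .ll => isLiftingPair_top_isomorphisms.llp_eq
  | .lll => isLiftingPair_isomorphisms_top.llp_eq
  | .lr => isLiftingPair_nonemptySource_emptySourceOrIso.llp_eq
  | .lrr => split_llp
  | .lrrl => clopenEmbeddings_llp
  | .lrrr => injections_llp
  | .lrrrl => quotients_llp
  | .lrrrr => isLiftingPair_injections_inducingSurjections.llp_eq
  | .lrrrrr => isLiftingPair_inducingSurjections_t0Fibres.llp_eq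
  | .r => surjections_llp
  | .rl => discreteExtensions_llp
  | .rll => clopenDense_llp
  | .rllr => isLiftingPair_clopenDense_rlp.llp_eq
  | .rllrr => genericallySplit_llp
  | .rllrrl => isLiftingPair_dense_closedEmbeddings.llp_eq
  | .rllrrll => dense_llp
  | .rr => isLiftingPair_surjections_embeddings.llp_eq
  | .rrr => isLiftingPair_embeddings_rlp.llp_eq
  | .rrrr => rfl
  | .rrrrl => t1Fibres_llp_llp

theorem Vertex.rlp_describe (x : Vertex) : x.describe.rlp = x.right.describe.{u} :=
  match x with
  | .l => nonemptySource_rlp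
  | .ll => isLiftingPair_isomorphisms_top.rlp_eq
  | .lll => isLiftingPair_top_isomorphisms.rlp_eq
  | .lr => emptySourceOrIso_rlp
  | .lrr => split_rlp
  | .lrrl => isLiftingPair_clopenEmbeddings_split.rlp_eq
  | .lrrr => isLiftingPair_injections_inducingSurjections.rlp_eq
  | .lrrrl => isLiftingPair_quotients_injections.rlp_eq
  | .lrrrr => isLiftingPair_inducingSurjections_t0Fibres.rlp_eq
  | .lrrrrr => t0Fibres_rlp
  | .r => isLiftingPair_surjections_embeddings.rlp_eq
  | .rl => isLiftingPair_discreteExtensions_surjections.rlp_eq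
  | .rll => rfl
  | .rllr => clopenDense_rlp_rlp
  | .rllrr => genericallySplit_rlp
  | .rllrrl => isLiftingPair_closedEmbeddings_genericallySplit.rlp_eq
  | .rllrrll => isLiftingPair_dense_closedEmbeddings.rlp_eq
  | .rr => rfl
  | .rrr => embeddings_rlp_rlp
  | .rrrr => t1Fibres_rlp
  | .rrrrl => isLiftingPair_t1Fibres_llp.rlp_eq

/-- The end point of the edge with a given label starting at a vertex. -/
def Vertex.step (x : Vertex) : Letter → Vertex
  | .l => x.left
  | .r => x.right

/-- The end point of the path that reads a given word from left to right, starting at a vertex. -/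
def Vertex.walk (x : Vertex) (w : List Letter) : Vertex :=
  w.foldl step x

theorem Vertex.orth_describe (a : Letter) (x : Vertex) :
    orth a x.describe = (x.step a).describe.{u} :=
  match a with
  | .l => x.llp_describe
  | .r => x.rlp_describe

theorem Vertex.act_describe (x : Vertex) (w : List Letter) :
    act x.describe w = (x.walk w).describe.{u} :=
  List.foldl_hom describe fun y a => orth_describe a y

/-- The vertex that is named by a given letter. -/
def Vertex.ofLetter : Letter → Vertex
  | .l => .l
  | .r => .r

theorem orth_emptyToPointClass (a : Letter) :
    orth a emptyToPointClass = (Vertex.ofLetter a).describe.{u} :=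
  match a with
  | .l => emptyToPointClass_llp
  | .r => emptyToPointClass_rlp

theorem act_cons_emptyToPointClass (a : Letter) (w : List Letter) :
    act emptyToPointClass (a :: w) = ((Vertex.ofLetter a).walk w).describe.{u} :=
  (congrArg (act · w) (orth_emptyToPointClass a)).trans (Vertex.act_describe _ w)

theorem Vertex.toClass_eq_describe : toClass.{u} = describe := by
  ext1 x
  cases x <;> exact act_cons_emptyToPointClass _ _

theorem Vertex.range_describe :
    range describe.{u} = iteratedOrthogonals emptyToPointClass := by
  refine Subset.antisymm (range_subset_iff.2 fun x => ?_) ?_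
  · exact ⟨x.word, by cases x <;> exact List.cons_ne_nil _ _, (congrFun toClass_eq_describe x).symm⟩
  · rintro _ ⟨_ | ⟨a, w⟩, hw, rfl⟩
    · exact absurd rfl hw
    · exact ⟨_, (act_cons_emptyToPointClass a w).symm⟩

theorem not_isIso_emptyToPoint : ¬ IsIso emptyToPoint.{u} := fun _ =>
  (inv emptyToPoint.{u} PUnit.unit).elim

theorem emptyToPointClass_notMem_iteratedOrthogonals :
    emptyToPointClass.{u} ∉ iteratedOrthogonals emptyToPointClass := fun h => by
  have id_mem : emptyToPointClass (𝟙 (TopCat.of PUnit.{u + 1})) :=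
    isomorphisms_le_of_mem_iteratedOrthogonals h _ (.infer_property _)
  have isEmpty_source : ∀ {A B : TopCat.{u}} (f : A ⟶ B), emptyToPointClass f → IsEmpty A := by
    rintro _ _ _ ⟨⟨⟩⟩
    exact inferInstanceAs (IsEmpty PEmpty)
  exact (isEmpty_source _ id_mem).elim PUnit.unit

theorem isomorphisms_ne_top : MorphismProperty.isomorphisms TopCat.{u} ≠ ⊤ := fun h =>
  not_isIso_emptyToPoint (h.ge emptyToPoint trivial)

theorem clopenDense_ne_dense : clopenDense.{u} ≠ dense := by
  let closedPoint : C(PUnit.{u + 1}, Sierp.{u}) := .const _ ⟨False⟩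
  intro h
  have closedPoint_mem : clopenDense (TopCat.ofHom closedPoint) := fun U hU hrange =>
    eq_univ_of_forall fun p => (true_specializes p).mem_closed hU.isClosed <|
      (true_specializes ⟨False⟩).mem_open hU.isOpen (hrange ⟨PUnit.unit, rfl⟩)
  obtain ⟨_, ⟨⟩⟩ :=
    (h.le _ closedPoint_mem).exists_mem_open isOpen_setOf_down ⟨⟨True⟩, trivial⟩

/-- The enumeration of the vertices in the order of their declaration. -/
def Vertex.equivFin : Vertex ≃ Fin 21 where
  toFun x := ⟨x.ctorIdx, by cases x <;> decide⟩
  invFun := ![.l, .ll, .lll, .lr, .lrr, .lrrl, .lrrr, .lrrrl, .lrrrr, .lrrrrr, .r, .rl, .rll,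
    .rllr, .rllrr, .rllrrl, .rllrrll, .rr, .rrr, .rrrr, .rrrrl]
  left_inv x := by cases x <;> rfl
  right_inv := by decide

instance : DecidableEq Vertex := Vertex.equivFin.decidableEq

instance : Fintype Vertex := .ofEquiv _ Vertex.equivFin.symm

theorem Vertex.card_eq : Nat.card Vertex = 21 :=
  Nat.card_eq_of_equiv_fin equivFin

/-- Words that lead every two distinct vertices to `ll` and `lll` or to `rll` and `rllrrll`, in
some order; found by a computer search. -/
def separatingWords : List (List Letter) :=
  [[],
   [.l],
   [.l, .l, .l, .l, .l, .l],
   [.r, .r, .r, .r, .r, .r],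
   [.l, .l, .r, .r, .r, .r, .r],
   [.l, .l, .l, .l, .r, .r, .r, .r, .r],
   [.r, .r, .l, .l, .l, .l, .l, .l],
   [.r, .l, .l, .l, .l, .l, .r, .r, .r, .r],
   [.r, .r, .r, .l, .l, .l, .l, .l, .r, .r, .r, .r],
   [.r, .r, .r, .r, .l, .l, .l, .l, .l, .r, .r, .r, .r],
   [.l, .r, .r, .r, .l, .l, .l, .l, .l, .r, .r, .r, .r],
   [.l, .r, .r, .r, .r, .l, .l, .l, .l, .l, .r, .r, .r, .r]]

theorem Vertex.exists_separatingWord : ∀ {x y : Vertex}, x ≠ y → ∃ w ∈ separatingWords,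
    s(x.walk w, y.walk w) = s(.ll, .lll) ∨ s(x.walk w, y.walk w) = s(.rll, .rllrrll) := by
  decide

theorem Vertex.injective_describe : Function.Injective describe.{u} := by
  intro x y h
  by_contra hxy
  obtain ⟨w, -, hw⟩ := exists_separatingWord hxy
  have walk_eq : (x.walk w).describe = (y.walk w).describe.{u} := by
    rw [← act_describe, h, act_describe]
  have map_eq : (s(x.walk w, y.walk w).map describe).IsDiag := walk_eq
  obtain hw | hw := hw <;> rw [hw] at map_eq
  · exact isomorphisms_ne_top map_eq
  · exact clopenDense_ne_dense map_eq

end SchreierGraph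

end QuillenNegation

theorem mainTheorem1 :
    (QuillenNegation.iteratedOrthogonals QuillenNegation.emptyToPointClass.{u}).Finite ∧
    (QuillenNegation.iteratedOrthogonals QuillenNegation.emptyToPointClass.{u}).ncard = 21 ∧
    QuillenNegation.emptyToPointClass.{u} ∉
      QuillenNegation.iteratedOrthogonals QuillenNegation.emptyToPointClass.{u} ∧
    Function.Injective QuillenNegation.Vertex.toClass.{u} ∧
    Set.range QuillenNegation.Vertex.toClass.{u} =
      QuillenNegation.iteratedOrthogonals QuillenNegation.emptyToPointClass.{u} ∧
    (∀ x : QuillenNegation.Vertex,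
      QuillenNegation.orth QuillenNegation.Letter.l x.toClass =
          (QuillenNegation.Vertex.toClass.{u} x.left) ∧
      QuillenNegation.orth QuillenNegation.Letter.r x.toClass =
          (QuillenNegation.Vertex.toClass.{u} x.right)) := by
  rw [← QuillenNegation.Vertex.range_describe, QuillenNegation.Vertex.toClass_eq_describe]
  have h := QuillenNegation.Vertex.injective_describe.{u}
  refine ⟨Set.finite_range _, ?_, ?_, h, rfl, fun x => ⟨x.llp_describe, x.rlp_describe⟩⟩
  · rw [← Nat.card_coe_set_eq, Nat.card_range_of_injective h, QuillenNegation.Vertex.card_eq]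
  · rw [QuillenNegation.Vertex.range_describe]
    exact QuillenNegation.emptyToPointClass_notMem_iteratedOrthogonals
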